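/- Let $D\ge 3$ and consider the FLRW metrics $$ds^2_{a,F}=-F(t)\,dt^2+\frac{a(t)^2}{1-kr^2}\,dr^2+a(t)^2r^2\,d\Omega^2_{D-2},\qquad k\in\{-1,0,1\},$$ where $a\neq 0$ and $F>0$ are $C^2$ functions on an open set of times, $r>0$, $kr^2<1$, and $d\Omega^2_{D-2}$ is the metric of the round unit $(D-2)$-sphere. Let $R_{abcd}$ be the Riemann tensor in the conventions $R_{abc}{}^{d}=-2\partial_{[a}\Gamma_{b]c}{}^{d}+2\Gamma_{c[a}{}^{e}\Gamma_{b]e}{}^{d}$, where $\Gamma_{ab}{}^{c}$ are the Christoffel symbols, let $R_{ab}=R_{adb}{}^{d}$ be the Ricci tensor, $R=R_b{}^b$ the Ricci scalar, $Z_{ab}=R_{ab}-\frac1D g_{ab}R$ the traceless Ricci tensor and $W_{abcd}$ the Weyl tensor. For the metric $ds^2_{a,F}$ one has $$R=\Sigma,\qquad Z_a{}^b=\Gamma\,(-D\,\delta_a^t\delta_t^b+\delta_a^b),$$ $$\Sigma=\frac{(D-1)\left((D-2)kF^2+(D-2)F\dot a^2-a\dot a\dot F+2a\ddot aF\right)}{a^2F^2},\qquad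 \Gamma=\frac{(D-2)\left(2kF^2+2F\dot a^2+a\dot a\dot F-2a\ddot aF\right)}{2a^2F^2D}.$$ For $m,p,q\ge 0$ let $(R^mW^pZ^q)_i$ denote any scalar obtained from the product of $m$ Ricci scalars, $p$ Weyl tensors and $q$ traceless Ricci tensors by contracting all the indices in pairs with the metric (according to a pairing of the index slots, labelled by $i$). Then, on all FLRW metrics $ds^2_{a,F}$ of dimension $D$: 1. if $p\ge 1$, then $(R^mW^pZ^q)_i|_{a,F}=0$; 2. if $p=0$, then $(R^mZ^q)_i|_{a,F}=c_i\,\Sigma^m\,\Gamma^q$ for a real constant $c_i$ that depends only on $D$, $m$, $q$ and the contraction $i$, and not on $k$, $a$, $F$ or the point; 3. all invariants of the same type $(m,p,q)$ that are non-zero on FLRW metrics are proportional to each other there: if $(R^mW^pZ^q)_j$ does not vanish on all of these metrics, then for every $i$ there is a real constant $c$ with $(R^mW^pZ^q)_i|_{a,F}=c\,(R^mW^pZ^q)_j|_{a,F}$ for all $k$, $a$, $F$ and at all points. -/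

import Mathlib

open scoped BigOperators

/-! ### Curvature of a (pseudo-)Riemannian metric in a coordinate chart

A metric in a chart with index type `ι` is a matrix-valued function `g` of the coordinates; its value
at `x` has the entries `g_{ab}(x)`. -/

noncomputable section

namespace CoordCurv

variable {ι : Type} [Fintype ι] [DecidableEq ι]

/-- The partial derivative `∂_i f` at the point `x`. -/
def partialDeriv (i : ι) (f : (ι → ℝ) → ℝ) (x : ι → ℝ) : ℝ :=
  deriv (fun s : ℝ => f (Function.update x i s)) (x i)

/-- The Christoffel symbols
`Γ_{ab}{}^c = ½ g^{cd} (∂_a g_{bd} + ∂_b g_{ad} - ∂_d g_{ab})`. -/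
def christoffel (g : (ι → ℝ) → Matrix ι ι ℝ) (a b c : ι) (x : ι → ℝ) : ℝ :=
  (1 / 2) * ∑ d : ι, (g x)⁻¹ c d *
    (partialDeriv a (fun y => g y b d) x + partialDeriv b (fun y => g y a d) x
      - partialDeriv d (fun y => g y a b) x)

/-- The Riemann tensor
`R_{abc}{}^d = -2 ∂_{[a} Γ_{b]c}{}^d + 2 Γ_{c[a}{}^e Γ_{b]e}{}^d`. -/
def riemannUp (g : (ι → ℝ) → Matrix ι ι ℝ) (x : ι → ℝ) (a b c d : ι) : ℝ :=
  -(partialDeriv a (christoffel g b c d) x - partialDeriv b (christoffel g a c d) x)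
    + ∑ e : ι, (christoffel g c a e x * christoffel g b e d x
        - christoffel g c b e x * christoffel g a e d x)

/-- The Riemann tensor with all indices down, `R_{abcd} = R_{abc}{}^e g_{ed}`. -/
def riemann (g : (ι → ℝ) → Matrix ι ι ℝ) (x : ι → ℝ) (a b c d : ι) : ℝ :=
  ∑ e : ι, riemannUp g x a b c e * g x e d

/-- The Ricci tensor `R_{ab} = R_{adb}{}^d`. -/
def ricci (g : (ι → ℝ) → Matrix ι ι ℝ) (x : ι → ℝ) (a b : ι) : ℝ :=
  ∑ d : ι, riemannUp g x a d b d

/-- The Ricci scalar `R = g^{ab} R_{ab}`. -/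
def scalarCurv (g : (ι → ℝ) → Matrix ι ι ℝ) (x : ι → ℝ) : ℝ :=
  ∑ a : ι, ∑ b : ι, (g x)⁻¹ a b * ricci g x a b

/-- The Weyl tensor
`W_{abcd} = R_{abcd} + 2/(D-2) (g_{b[c} R_{d]a} - g_{a[c} R_{d]b})
  + 2/((D-1)(D-2)) R g_{c[a} g_{b]d}`, where `D` is the dimension. -/
def weyl (g : (ι → ℝ) → Matrix ι ι ℝ) (x : ι → ℝ) (a b c d : ι) : ℝ :=
  riemann g x a b c d
    + 1 / ((Fintype.card ι : ℝ) - 2) *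
      ((g x b c * ricci g x d a - g x b d * ricci g x c a)
        - (g x a c * ricci g x d b - g x a d * ricci g x c b))
    + 1 / (((Fintype.card ι : ℝ) - 1) * ((Fintype.card ι : ℝ) - 2)) * scalarCurv g x *
      (g x c a * g x b d - g x c b * g x a d)

/-- The traceless Ricci tensor `Z_{ac} = R_{ac} - (1/D) g_{ac} R`. -/
def tracelessRicci (g : (ι → ℝ) → Matrix ι ι ℝ) (x : ι → ℝ) (a c : ι) : ℝ :=
  ricci g x a c - 1 / (Fintype.card ι : ℝ) * g x a c * scalarCurv g x

/-- The traceless Ricci tensor with its second index raised, `Z_a{}^b = Z_{ac} g^{cb}`. -/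
def tracelessRicciUp (g : (ι → ℝ) → Matrix ι ι ℝ) (x : ι → ℝ) (a b : ι) : ℝ :=
  ∑ c : ι, tracelessRicci g x a c * (g x)⁻¹ c b

/-! ### Complete contractions -/

/-- The index slots of a product of `p` Weyl tensors (four slots each) and `q` traceless Ricci
tensors (two slots each). -/
abbrev Slot (p q : ℕ) : Type := (Fin p × Fin 4) ⊕ (Fin q × Fin 2)

/-- A way of contracting all indices of a product of `p` Weyl tensors and `q` traceless Ricci
tensors: an arrangement of the `4 p + 2 q` slots into `2 p + q` pairs. The `j`-th pair consists of
the images of `(j, 0)` and `(j, 1)`. -/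
abbrev Contraction (p q : ℕ) : Type := (Fin (2 * p + q) × Fin 2) ≃ Slot p q

/-- The curvature invariant `(R^m W^p Z^q)_σ` at the point `x`: the product of `m` Ricci scalars
with the complete contraction, prescribed by `σ`, of `p` Weyl tensors and `q` traceless Ricci
tensors. All tensors have their indices down, each pair of slots is contracted with the inverse
metric, and the sum runs over all assignments `f` of coordinate indices to slots. -/
def invariant (g : (ι → ℝ) → Matrix ι ι ℝ) (m : ℕ) {p q : ℕ} (σ : Contraction p q)
    (x : ι → ℝ) : ℝ :=
  scalarCurv g x ^ m *
    ∑ f : Slot p q → ι,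
      (∏ i : Fin p, weyl g x (f (Sum.inl (i, 0))) (f (Sum.inl (i, 1)))
        (f (Sum.inl (i, 2))) (f (Sum.inl (i, 3))))
      * (∏ i : Fin q, tracelessRicci g x (f (Sum.inr (i, 0))) (f (Sum.inr (i, 1))))
      * ∏ j : Fin (2 * p + q), (g x)⁻¹ (f (σ (j, 0))) (f (σ (j, 1)))

end CoordCurv

/-! ### FLRW backgrounds -/

/-- The data of an FLRW ansatz: the curvature parameter `k ∈ {-1, 0, 1}`, the scale factor `a(t)` and
the function `F(t)`, defined for `t` in an open set, where they are of class `C²`, with `F` positive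
and `a` nowhere zero (so that the metric is Lorentzian). -/
structure FLRW where
  k : ℝ
  a : ℝ → ℝ
  F : ℝ → ℝ
  times : Set ℝ
  k_eq : k = -1 ∨ k = 0 ∨ k = 1
  times_open : IsOpen times
  a_contDiff : ContDiffOn ℝ 2 a times
  F_contDiff : ContDiffOn ℝ 2 F times
  a_ne : ∀ t ∈ times, a t ≠ 0
  F_pos : ∀ t ∈ times, 0 < F t

namespace FLRW

/-- The FLRW metric
`-F(t) dt² + a(t)²/(1 - k r²) dr² + a(t)² r² dΩ²_n` in dimension `D = n + 2`. The coordinates are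
`t` (index `0`), `r` (index `1`) and stereographic coordinates `y` on the unit sphere `Sⁿ` (the
other `n` indices), in which the round metric is `dΩ²_n = 4 |dy|² / (1 + |y|²)²`. -/
def metric (B : FLRW) (n : ℕ) (x : Fin (n + 2) → ℝ) : Matrix (Fin (n + 2)) (Fin (n + 2)) ℝ :=
  Matrix.diagonal
    (Fin.cons (-B.F (x 0))
      (Fin.cons (B.a (x 0) ^ 2 / (1 - B.k * x 1 ^ 2))
        (fun _ : Fin n =>
          B.a (x 0) ^ 2 * x 1 ^ 2 * (4 / (1 + ∑ i : Fin n, x i.succ.succ ^ 2) ^ 2))))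

/-- The coordinate domain of the FLRW metric: `t` is an admissible time, `r > 0` and `k r² < 1`. -/
def domain (B : FLRW) (n : ℕ) : Set (Fin (n + 2) → ℝ) :=
  {x | x 0 ∈ B.times ∧ 0 < x 1 ∧ B.k * x 1 ^ 2 < 1}

/-- `Σ = (D-1) ((D-2) k F² + (D-2) F ȧ² - a ȧ Ḟ + 2 a ä F) / (a² F²)`. -/
def Sig (B : FLRW) (D : ℕ) (t : ℝ) : ℝ :=
  ((D : ℝ) - 1) *
    (((D : ℝ) - 2) * B.k * B.F t ^ 2 + ((D : ℝ) - 2) * B.F t * deriv B.a t ^ 2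
      - B.a t * deriv B.a t * deriv B.F t + 2 * B.a t * deriv (deriv B.a) t * B.F t)
    / (B.a t ^ 2 * B.F t ^ 2)

/-- `Γ = (D-2) (2 k F² + 2 F ȧ² + a ȧ Ḟ - 2 a ä F) / (2 a² F² D)`. -/
def Gam (B : FLRW) (D : ℕ) (t : ℝ) : ℝ :=
  ((D : ℝ) - 2) *
    (2 * B.k * B.F t ^ 2 + 2 * B.F t * deriv B.a t ^ 2
      + B.a t * deriv B.a t * deriv B.F t - 2 * B.a t * deriv (deriv B.a) t * B.F t)
    / (2 * B.a t ^ 2 * B.F t ^ 2 * (D : ℝ))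

end FLRW

end

/-! In the chart (t, r, stereographic y) the FLRW metric is diagonal, and its Riemann tensor is
κ_{ab} (g_{ac} g_{bd} - g_{bc} g_{ad}), where κ_{ab} takes only two values: K_t (`timeCurv`) on
planes containing the time direction and K_s (`spaceCurv`) on spatial planes.
`DiagonalJet.riemannUp_eq` reduces this form, for any diagonal metric, to identities between
logarithmic derivatives; `logDer_mixed` and `logDer_sect` verify them.

Everything else is algebra in K_t and K_s. The Ricci tensor is diagonal, with one eigenvalue in the
time direction and another in all spatial ones. Its traceless part is therefore a multiple of
diag(-(D-1), 1, ..., 1), with factor Γ = (D-2)/D (K_s - K_t). The Ricci tensor determines κ exactly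
as it does when the Weyl tensor vanishes, so W = 0.

For a contraction of q copies of Z, a term survives only if the indices agree within each Z and
within each contracted pair. The metric entries from the Z's then cancel the inverse entries from
the contractions (`prod_pairs_eq`), leaving Γ^q times a sum of products of the fixed eigenvalues.
That sum is c_i, and proportionality follows by dividing two such constants. -/

namespace CoordCurv

/-! ### Curvature of a diagonal metric in terms of logarithmic derivatives -/

variable {ι : Type} [Fintype ι] [DecidableEq ι]

/-- `L c a` is the logarithmic derivative `∂_a G_c / (2 G_c)` of the entries of the diagonal metric
`G` on `U`, and `dL c a b` is the derivative `∂_b L_{c,a}`. -/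
structure DiagonalJet (U : Set (ι → ℝ)) (G : (ι → ℝ) → ι → ℝ) (L : ι → ι → (ι → ℝ) → ℝ)
    (dL : ι → ι → ι → (ι → ℝ) → ℝ) : Prop where
  isOpen : IsOpen U
  ne_zero : ∀ x ∈ U, ∀ c, G x c ≠ 0
  hasDerivAt_metric : ∀ x ∈ U, ∀ a c,
    HasDerivAt (fun s : ℝ => G (Function.update x a s) c) (2 * L c a x * G x c) (x a)
  hasDerivAt_log : ∀ x ∈ U, ∀ c a b,
    HasDerivAt (fun s : ℝ => L c a (Function.update x b s)) (dL c a b x) (x b)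

omit [Fintype ι] in
theorem eventually_update_mem {U : Set (ι → ℝ)} (hU : IsOpen U) {x : ι → ℝ} (hx : x ∈ U) (i : ι) :
    ∀ᶠ s in nhds (x i), Function.update x i s ∈ U := by
  have hc : Continuous fun s : ℝ => Function.update x i s := by fun_prop
  exact hc.continuousAt.eventually_mem (hU.mem_nhds (by simpa using hx))

theorem inv_diagonal_apply {v : ι → ℝ} (hv : ∀ c, v c ≠ 0) (a b : ι) :
    (Matrix.diagonal v)⁻¹ a b = if a = b then (v a)⁻¹ else 0 := by
  have h : (Matrix.diagonal v)⁻¹ = Matrix.diagonal fun c => (v c)⁻¹ := by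
    apply Matrix.inv_eq_right_inv
    simp [Matrix.diagonal_mul_diagonal, hv]
  rw [h, Matrix.diagonal_apply]

namespace DiagonalJet

variable {U : Set (ι → ℝ)} {G : (ι → ℝ) → ι → ℝ} {L : ι → ι → (ι → ℝ) → ℝ}
  {dL : ι → ι → ι → (ι → ℝ) → ℝ}

omit [Fintype ι] in
theorem partialDeriv_metric (J : DiagonalJet U G L dL) {x : ι → ℝ} (hx : x ∈ U) (a b c : ι) :
    partialDeriv a (fun y => Matrix.diagonal (G y) b c) x
      = if b = c then 2 * L c a x * G x c else 0 := by
  unfold partialDeriv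
  by_cases h : b = c
  · subst h
    simpa using (J.hasDerivAt_metric x hx a b).deriv
  · simp [h]

theorem christoffel_eq (J : DiagonalJet U G L dL) {x : ι → ℝ} (hx : x ∈ U) (a b c : ι) :
    christoffel (fun y => Matrix.diagonal (G y)) a b c x
      = (if b = c then L c a x else 0) + (if a = c then L c b x else 0)
        - (if a = b then G x a / G x c * L a c x else 0) := by
  have hc := J.ne_zero x hx c
  simp only [christoffel, J.partialDeriv_metric hx, inv_diagonal_apply (J.ne_zero x hx)]
  simp only [ite_mul, zero_mul, Finset.sum_ite_eq, Finset.mem_univ, if_true]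
  split_ifs <;> subst_vars <;> first | contradiction | (field_simp; done) | (field_simp; ring)

omit [Fintype ι] in
theorem hasDerivAt_ratio (J : DiagonalJet U G L dL) {x : ι → ℝ} (hx : x ∈ U) (a b c e : ι) :
    HasDerivAt (fun s : ℝ => G (Function.update x e s) a / G (Function.update x e s) c
        * L a b (Function.update x e s))
      (G x a / G x c * (2 * (L a e x - L c e x) * L a b x + dL a b e x)) (x e) := by
  have hc := J.ne_zero x hx c
  have h := ((J.hasDerivAt_metric x hx e a).div (J.hasDerivAt_metric x hx e c)
    (by simpa using hc)).mul (J.hasDerivAt_log x hx a b e)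
  simp only [Function.update_eq_self] at h
  refine h.congr_deriv ?_
  simp only [Pi.div_apply, Function.update_eq_self]
  field_simp

theorem partialDeriv_christoffel (J : DiagonalJet U G L dL) {x : ι → ℝ} (hx : x ∈ U)
    (e a b c : ι) :
    partialDeriv e (christoffel (fun y => Matrix.diagonal (G y)) a b c) x
      = (if b = c then dL c a e x else 0) + (if a = c then dL c b e x else 0)
        - (if a = b then G x a / G x c * (2 * (L a e x - L c e x) * L a c x + dL a c e x)
            else 0) := by
  unfold partialDeriv
  -- The closed formula holds only on `U`; openness gives it along the coordinate line near x, which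
  -- suffices for the derivative.
  have h : (fun s : ℝ => christoffel (fun y => Matrix.diagonal (G y)) a b c (Function.update x e s))
      =ᶠ[nhds (x e)] fun s => (if b = c then L c a (Function.update x e s) else 0)
        + (if a = c then L c b (Function.update x e s) else 0)
        - (if a = b then G (Function.update x e s) a / G (Function.update x e s) c
            * L a c (Function.update x e s) else 0) := by
    filter_upwards [eventually_update_mem J.isOpen hx e] with s hs
    exact J.christoffel_eq hs a b c
  rw [h.deriv_eq]
  refine HasDerivAt.deriv ?_
  refine HasDerivAt.sub (HasDerivAt.add ?_ ?_) ?_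
  · split_ifs
    exacts [J.hasDerivAt_log x hx c a e, hasDerivAt_const _ _]
  · split_ifs
    exacts [J.hasDerivAt_log x hx c b e, hasDerivAt_const _ _]
  · split_ifs
    exacts [J.hasDerivAt_ratio hx a c c e, hasDerivAt_const _ _]

/-- Every product of terms contains a Kronecker delta in e, which collapses the sum, except when c =
a and b = d: there a genuine sum over e survives. -/
theorem sum_christoffel_mul (J : DiagonalJet U G L dL) {x : ι → ℝ} (hx : x ∈ U) (a b c d : ι) :
    ∑ e, christoffel (fun y => Matrix.diagonal (G y)) c a e x
        * christoffel (fun y => Matrix.diagonal (G y)) b e d x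
      = L a c x * ((if a = d then L d b x else 0) + (if b = d then L d a x else 0)
            - (if b = a then G x b / G x d * L b d x else 0))
        + L c a x * ((if c = d then L d b x else 0) + (if b = d then L d c x else 0)
            - (if b = c then G x b / G x d * L b d x else 0))
        - (if c = a then G x c / G x d * L c d x * L d b x
            + (if b = d then ∑ e, G x c / G x e * L c e x * L d e x else 0)
            - G x c / G x b * L c b x * (G x b / G x d * L b d x) else 0) := by
  simp only [J.christoffel_eq hx]
  have h : ∀ e, ((if a = e then L e c x else 0) + (if c = e then L e a x else 0)
        - (if c = a then G x c / G x e * L c e x else 0))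
      * ((if e = d then L d b x else 0) + (if b = d then L d e x else 0)
        - (if b = e then G x b / G x d * L b d x else 0))
    = (if a = e then L e c x * ((if e = d then L d b x else 0) + (if b = d then L d e x else 0)
        - (if b = e then G x b / G x d * L b d x else 0)) else 0)
      + (if c = e then L e a x * ((if e = d then L d b x else 0) + (if b = d then L d e x else 0)
        - (if b = e then G x b / G x d * L b d x else 0)) else 0)
      - ((if e = d then (if c = a then G x c / G x e * L c e x * L d b x else 0) else 0)
        + (if c = a then (if b = d then G x c / G x e * L c e x * L d e x else 0) else 0)
        - (if b = e then (if c = a then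
            G x c / G x e * L c e x * (G x b / G x d * L b d x) else 0) else 0)) := by
    intro e
    split_ifs <;> ring
  simp only [h, Finset.sum_add_distrib, Finset.sum_sub_distrib, Finset.sum_ite_eq,
    Finset.sum_ite_eq', Finset.mem_univ, if_true]
  by_cases h1 : c = a <;> by_cases h2 : b = d <;> simp [h1]

/-- A diagonal metric has Riemann tensor `κ_{ab} (g_{ac} g_{bd} - g_{bc} g_{ad})` as soon as its
components with exactly three distinct indices vanish and the sectional curvatures are `κ_{ab}`. -/
theorem riemannUp_eq (J : DiagonalJet U G L dL) {x : ι → ℝ} (hx : x ∈ U) {κ : ι → ι → ℝ}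
    (hκ : ∀ a b, κ a b = κ b a) (hsymm : ∀ a b c, dL c a b x = dL c b a x)
    (hmixed : ∀ a b c, a ≠ b → a ≠ c → b ≠ c →
      dL a c b x + L a c x * L a b x - L b c x * L a b x - L c b x * L a c x = 0)
    (hsect : ∀ a b, a ≠ b →
      -dL b a a x - G x a / G x b * (2 * (L a b x - L b b x) * L a b x + dL a b b x)
        + 2 * L a a x * L b a x - ∑ e, G x a / G x e * L a e x * L b e x - L b a x ^ 2
        + G x a / G x b * L a b x ^ 2 = κ a b * G x a) (a b c d : ι) :
    riemannUp (fun y => Matrix.diagonal (G y)) x a b c d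
      = κ a b * ((if a = c ∧ b = d then G x a else 0) - (if b = c ∧ a = d then G x b else 0)) := by
  have hne := J.ne_zero x hx
  by_cases hab : a = b
  · subst hab
    simp [riemannUp]
  have hba : b ≠ a := Ne.symm hab
  simp only [riemannUp, J.partialDeriv_christoffel hx, Finset.sum_sub_distrib,
    J.sum_christoffel_mul hx]
  -- The cases follow the coincidences among the indices: two distinct values in a sectional pattern
  -- use `hsect`, exactly three distinct indices use `hmixed`, and the components that must vanish
  -- by antisymmetry use `hsymm`.
  by_cases hca : c = a
  · subst hca
    by_cases hdc : d = c
    · subst hdc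
      have h1 := div_self (hne d)
      have h2 : G x d / G x b * (G x b / G x d) = 1 := by
        have := hne b
        have := hne d
        field_simp
      simp [hab, hba, h1]
      linear_combination -hsymm b d d + L d b x * L b d x * h2
    by_cases hdb : d = b
    · subst hdb
      have h := hsect c d hab
      have h1 := div_self (hne d)
      simp [hab, hba, h1]
      linear_combination h
    · have h := hmixed c b d hab (Ne.symm hdc) (Ne.symm hdb)
      have h1 : G x c / G x b * (G x b / G x d) = G x c / G x d := by
        have := hne b
        have := hne d
        field_simp
      simp [hab, hba, Ne.symm hdc, Ne.symm hdb]
      linear_combination -(G x c / G x d) * h + L c b x * L b d x * h1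
  by_cases hcb : c = b
  · subst hcb
    by_cases hdc : d = c
    · subst hdc
      have h1 := div_self (hne d)
      have h2 : G x d / G x a * (G x a / G x d) = 1 := by
        have := hne a
        have := hne d
        field_simp
      simp [hab, hba, h1]
      linear_combination hsymm a d d - L d a x * L a d x * h2
    by_cases hda : d = a
    · subst hda
      have h := hsect c d hba
      have h1 := div_self (hne d)
      simp [hab, hba, h1]
      linear_combination -h + hκ d c * G x c
    · have h := hmixed c a d hba (Ne.symm hdc) (Ne.symm hda)
      have h1 : G x c / G x a * (G x a / G x d) = G x c / G x d := by
        have := hne a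
        have := hne d
        field_simp
      simp [hab, hba, Ne.symm hdc, Ne.symm hda]
      linear_combination (G x c / G x d) * h - L c a x * L a d x * h1
  have hac : a ≠ c := Ne.symm hca
  have hbc : b ≠ c := Ne.symm hcb
  by_cases hda : d = a
  · subst hda
    have h := hmixed d b c hab hac hbc
    simp [hab, hba, hca, hcb, hac, hbc]
    linear_combination h
  by_cases hdb : d = b
  · subst hdb
    have h := hmixed d a c hba hbc hac
    simp [hab, hba, hca, hcb, hac, hbc]
    linear_combination -h
  by_cases hdc : d = c
  · subst hdc
    simp [hab, hba, hca, hcb, hac, hbc]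
    linear_combination hsymm a b d
  · simp [hab, hba, hca, hcb, hac, hbc, Ne.symm hda, Ne.symm hdb, Ne.symm hdc]

end DiagonalJet
end CoordCurv

/-! ### Complete contractions of diagonal tensors -/

namespace CoordCurv

/-- If the values of `h` agree on the two members of every pair, then the multiset of all values is
twice the multiset of the values on the first members. -/
theorem sum_singleton_pairs {α β : Type*} [Fintype β] (h : β × Fin 2 → α)
    (hh : ∀ i, h (i, 0) = h (i, 1)) :
    ∑ s, ({h s} : Multiset α) = 2 • (Finset.univ : Finset β).val.map fun i => h (i, 0) := by
  rw [Fintype.sum_prod_type]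
  simp only [Fin.sum_univ_two, ← hh, ← two_nsmul, Finset.sum_nsmul]
  congr 1
  rw [Finset.sum_eq_multiset_sum, ← Multiset.sum_map_singleton (Multiset.map (fun i => h (i, 0)) _),
    Multiset.map_map]
  rfl

/-- Two arrangements of the same values in pairs of equal values give the same multiset of values of
the pairs, hence the same products. -/
theorem prod_pairs_eq {α β γ M : Type*} [Fintype β] [Fintype γ] [CommMonoid M]
    (e : γ × Fin 2 ≃ β × Fin 2) (h : β × Fin 2 → α) (hβ : ∀ i, h (i, 0) = h (i, 1))
    (hγ : ∀ j, h (e (j, 0)) = h (e (j, 1))) (w : α → M) :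
    ∏ i, w (h (i, 0)) = ∏ j, w (h (e (j, 0))) := by
  classical
  have h1 := sum_singleton_pairs h hβ
  have h2 := sum_singleton_pairs (fun s => h (e s)) hγ
  rw [e.sum_comp fun s => ({h s} : Multiset α), h1] at h2
  have h3 : (Finset.univ : Finset β).val.map (fun i => h (i, 0))
      = (Finset.univ : Finset γ).val.map fun j => h (e (j, 0)) := by
    ext c
    -- Both multisets, doubled, are the multiset of values over all slots; comparing multiplicities
    -- removes the factor 2.
    have := congrArg (Multiset.count c) h2
    simpa [Multiset.count_nsmul] using this
  have h4 := congrArg (fun s => (s.map w).prod) h3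
  simpa only [Multiset.map_map, Function.comp_def, Finset.prod_map_val] using h4

variable {ι : Type} [Fintype ι] [DecidableEq ι]

/-- The value of the contraction `σ` of `q` copies of the endomorphism `diag ζ`. -/
def diagonalContraction (ζ : ι → ℝ) {q : ℕ} (σ : Contraction 0 q) : ℝ :=
  ∑ f : Slot 0 q → ι,
    (∏ i : Fin q, if f (Sum.inr (i, 0)) = f (Sum.inr (i, 1)) then ζ (f (Sum.inr (i, 0))) else 0)
      * ∏ j : Fin (2 * 0 + q), if f (σ (j, 0)) = f (σ (j, 1)) then 1 else 0

/-- On a diagonal metric with `Z_{ab} = γ ζ_a g_{ab}` the contractions of `Z ⊗ ⋯ ⊗ Z` are constant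
multiples of `γ^q`. -/
theorem invariant_eq_diagonalContraction {g : (ι → ℝ) → Matrix ι ι ℝ} {x : ι → ℝ} {v ζ : ι → ℝ}
    {γ : ℝ} (hg : g x = Matrix.diagonal v) (hv : ∀ c, v c ≠ 0)
    (hZ : ∀ a b, tracelessRicci g x a b = if a = b then γ * ζ a * v a else 0)
    (m : ℕ) {q : ℕ} (σ : Contraction 0 q) :
    invariant g m σ x = diagonalContraction ζ σ * scalarCurv g x ^ m * γ ^ q := by
  unfold invariant diagonalContraction
  rw [mul_right_comm, mul_comm _ (scalarCurv g x ^ m), Finset.sum_mul, Finset.sum_congr rfl]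
  intro f _
  rw [hg]
  simp only [hZ, inv_diagonal_apply hv]
  simp only [Finset.univ_eq_empty, Finset.prod_empty, one_mul]
  -- If a pair of either kind carries two different indices, both sides have a zero factor.
  -- Otherwise the products of v over the Z's and of its inverse over the contractions cancel.
  by_cases h1 : ∀ i : Fin q, f (Sum.inr (i, 0)) = f (Sum.inr (i, 1))
  · by_cases h2 : ∀ j : Fin (2 * 0 + q), f (σ (j, 0)) = f (σ (j, 1))
    · simp only [h1, h2, if_true]
      have hs : ∀ s : Slot 0 q, Sum.inr (Equiv.emptySum (Fin 0 × Fin 4) (Fin q × Fin 2) s) = s := by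
        rintro (s | s)
        · exact s.1.elim0
        · rfl
      have h3 := prod_pairs_eq (σ.trans (Equiv.emptySum (Fin 0 × Fin 4) (Fin q × Fin 2)))
        (fun s => f (Sum.inr s)) h1 (fun j => by simpa only [Equiv.trans_apply, hs] using h2 j) v
      simp only [Equiv.trans_apply, hs] at h3
      have h4 : ∏ j : Fin (2 * 0 + q), v (f (σ (j, 0))) ≠ 0 :=
        Finset.prod_ne_zero_iff.mpr fun j _ => hv _
      simp only [h1] at h3
      simp only [h2] at h3 h4
      simp only [Finset.prod_mul_distrib, Finset.prod_inv_distrib, Finset.prod_const_one, h3]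
      simp only [Finset.prod_const, Finset.card_univ, Fintype.card_fin]
      field_simp
    · push Not at h2
      obtain ⟨j, hj⟩ := h2
      rw [Finset.prod_eq_zero (Finset.mem_univ j) (if_neg hj),
        Finset.prod_eq_zero (Finset.mem_univ j) (if_neg hj)]
      simp
  · push Not at h1
    obtain ⟨i, hi⟩ := h1
    rw [Finset.prod_eq_zero (Finset.mem_univ i) (if_neg hi),
      Finset.prod_eq_zero (Finset.mem_univ i) (if_neg hi)]
    simp

/-- A contraction with a vanishing Weyl tensor vanishes. -/
theorem invariant_eq_zero {g : (ι → ℝ) → Matrix ι ι ℝ} {x : ι → ℝ}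
    (hW : ∀ a b c d, weyl g x a b c d = 0) (m : ℕ) {p q : ℕ} (σ : Contraction p q) (hp : 1 ≤ p) :
    invariant g m σ x = 0 := by
  have : Nonempty (Fin p) := ⟨⟨0, hp⟩⟩
  have hp' : p ≠ 0 := by omega
  simp [invariant, hW, hp']

end CoordCurv

/-! ### Ricci, traceless Ricci and Weyl tensors from sectional curvatures -/

namespace CoordCurv

variable {ι : Type} [Fintype ι] [DecidableEq ι]

/-- The Riemann tensor at `x` of a metric with diagonal value `v` there is
`κ_{ab} (g_{ac} g_{bd} - g_{bc} g_{ad})`. -/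
structure SectionalAt (g : (ι → ℝ) → Matrix ι ι ℝ) (x : ι → ℝ) (v : ι → ℝ) (κ : ι → ι → ℝ) :
    Prop where
  metric_eq : g x = Matrix.diagonal v
  ne_zero : ∀ c, v c ≠ 0
  riemannUp_eq : ∀ a b c d, riemannUp g x a b c d
    = κ a b * ((if a = c ∧ b = d then v a else 0) - (if b = c ∧ a = d then v b else 0))

namespace SectionalAt

variable {g : (ι → ℝ) → Matrix ι ι ℝ} {x v : ι → ℝ} {κ : ι → ι → ℝ}

/-- The bracket multiplying κ_{ad} vanishes for d = a, so the meaningless value κ_{aa} has to be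
removed from the row sum. -/
theorem ricci_eq (S : SectionalAt g x v κ) (a b : ι) :
    ricci g x a b = if a = b then v a * (∑ d, κ a d - κ a a) else 0 := by
  simp only [ricci, S.riemannUp_eq]
  by_cases h : a = b
  · subst h
    simp only [and_true, if_true, mul_sub, Finset.sum_sub_distrib, mul_ite, mul_zero]
    have h1 : ∀ d, (if d = a ∧ a = d then κ a d * v d else 0) = if d = a then κ a d * v d else 0 :=
      fun d => by simp only [eq_comm (a := a), and_self]
    simp only [h1, Finset.sum_ite_eq', Finset.mem_univ, if_true, ← Finset.sum_mul]
    ring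
  · have h1 : ∀ d, ¬(d = b ∧ a = d) := fun d hd => h (hd.2.trans hd.1)
    simp [h, h1]

theorem scalarCurv_eq (S : SectionalAt g x v κ) :
    scalarCurv g x = ∑ a, (∑ d, κ a d - κ a a) := by
  simp only [scalarCurv, S.ricci_eq, S.metric_eq, inv_diagonal_apply S.ne_zero]
  refine Finset.sum_congr rfl fun a _ => ?_
  have := S.ne_zero a
  simp only [ite_mul, zero_mul, Finset.sum_ite_eq, Finset.mem_univ, if_true]
  field_simp

theorem riemann_eq (S : SectionalAt g x v κ) (a b c d : ι) :
    riemann g x a b c d = κ a b * v a * v b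
      * ((if a = c ∧ b = d then 1 else 0) - (if b = c ∧ a = d then 1 else 0)) := by
  simp only [riemann, S.riemannUp_eq, S.metric_eq, Matrix.diagonal_apply, mul_ite, mul_zero,
    Finset.sum_ite_eq', Finset.mem_univ, if_true]
  by_cases h1 : a = c ∧ b = d
  · obtain ⟨rfl, rfl⟩ := h1
    by_cases h2 : a = b
    · subst h2; simp
    · simp [h2]
  · by_cases h2 : b = c ∧ a = d
    · obtain ⟨rfl, rfl⟩ := h2
      simp [h1]; ring
    · simp [h1, h2]

theorem tracelessRicci_eq (S : SectionalAt g x v κ) (a b : ι) :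
    tracelessRicci g x a b = if a = b
      then (∑ d, κ a d - κ a a - scalarCurv g x / Fintype.card ι) * v a else 0 := by
  simp only [tracelessRicci, S.ricci_eq, S.metric_eq, Matrix.diagonal_apply]
  split_ifs <;> ring

theorem tracelessRicciUp_eq (S : SectionalAt g x v κ) (a b : ι) :
    tracelessRicciUp g x a b = if a = b
      then ∑ d, κ a d - κ a a - scalarCurv g x / Fintype.card ι else 0 := by
  have hb := S.ne_zero b
  simp only [tracelessRicciUp, S.tracelessRicci_eq, S.metric_eq, inv_diagonal_apply S.ne_zero,
    mul_ite, mul_zero, Finset.sum_ite_eq', Finset.mem_univ, if_true]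
  split_ifs with h
  · subst h
    field_simp
  · simp

/-- The Weyl tensor vanishes if the sectional curvatures are determined by the Ricci tensor as they
are for a conformally flat metric. -/
theorem weyl_eq_zero (S : SectionalAt g x v κ)
    (h : ∀ a b, a ≠ b → κ a b
      - 1 / ((Fintype.card ι : ℝ) - 2)
        * ((∑ d, κ a d - κ a a) + (∑ d, κ b d - κ b b))
      + 1 / (((Fintype.card ι : ℝ) - 1) * ((Fintype.card ι : ℝ) - 2)) * scalarCurv g x = 0)
    (a b c d : ι) : weyl g x a b c d = 0 := by
  simp only [weyl, S.riemann_eq, S.ricci_eq, S.metric_eq, Matrix.diagonal_apply]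
  generalize 1 / ((Fintype.card ι : ℝ) - 2) = A at *
  generalize 1 / (((Fintype.card ι : ℝ) - 1) * ((Fintype.card ι : ℝ) - 2)) = C at *
  by_cases hab : a = b
  · subst hab
    by_cases h1 : a = c <;> by_cases h2 : a = d <;> simp [h1, h2]
  have hba := Ne.symm hab
  by_cases h1 : a = c ∧ b = d
  · obtain ⟨rfl, rfl⟩ := h1
    simp [hab, hba]
    linear_combination v a * v b * h a b hab
  by_cases h2 : b = c ∧ a = d
  · obtain ⟨rfl, rfl⟩ := h2
    simp [hab, hba]
    linear_combination -v a * v b * h a b hab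
  · by_cases h3 : a = c
    · subst h3
      have h4 : b ≠ d := fun h => h1 ⟨rfl, h⟩
      simp [hba, hab, h4, Ne.symm h4]
    · by_cases h4 : b = c
      · subst h4
        have h5 : a ≠ d := fun h => h2 ⟨rfl, h⟩
        simp [hba, hab, h5, Ne.symm h5]
      · simp [h3, h4, Ne.symm h3, Ne.symm h4]

end SectionalAt
end CoordCurv

/-! ### The FLRW metric as a diagonal metric -/

noncomputable section

namespace FLRW

open CoordCurv

/-- The sum of the squares of the stereographic coordinates. -/
def normSq {n : ℕ} (x : Fin (n + 2) → ℝ) : ℝ := ∑ i : Fin n, x i.succ.succ ^ 2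

/-- The function on the indices of an FLRW chart with the values `t` at the time index, `r` at the
radial index, and `y` at the angular indices. -/
def byIndex {α : Type*} {n : ℕ} (t r : α) (y : Fin n → α) : Fin (n + 2) → α :=
  Fin.cons t (Fin.cons r y)

section byIndex

variable {α : Type*} {n : ℕ} (t r : α) (y : Fin n → α)

@[simp] theorem byIndex_zero : byIndex t r y 0 = t := rfl

@[simp] theorem byIndex_one : byIndex t r y 1 = r := rfl

@[simp] theorem byIndex_succ_succ (i : Fin n) : byIndex t r y i.succ.succ = y i := rfl

@[elab_as_elim]
theorem index_cases {motive : Fin (n + 2) → Prop} (zero : motive 0) (one : motive 1)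
    (angle : ∀ i : Fin n, motive i.succ.succ) (c : Fin (n + 2)) : motive c :=
  Fin.cases zero (fun c => Fin.cases one angle c) c

@[simp] theorem succ_succ_ne_one (i : Fin n) : i.succ.succ ≠ 1 := fun h =>
  Fin.succ_ne_zero i (Fin.succ_injective _ h)

@[simp] theorem one_ne_succ_succ (i : Fin n) : 1 ≠ i.succ.succ := (succ_succ_ne_one i).symm

@[simp] theorem zero_ne_succ_succ (i : Fin n) : 0 ≠ i.succ.succ := (Fin.succ_ne_zero _).symm

end byIndex

/-- The diagonal entries of the FLRW metric. -/
def entries (B : FLRW) (n : ℕ) (x : Fin (n + 2) → ℝ) : Fin (n + 2) → ℝ :=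
  byIndex (-B.F (x 0)) (B.a (x 0) ^ 2 / (1 - B.k * x 1 ^ 2))
    (fun _ => B.a (x 0) ^ 2 * x 1 ^ 2 * (4 / (1 + normSq x) ^ 2))

/-- The logarithmic derivatives `∂_a g_{cc} / (2 g_{cc})` of the FLRW metric. -/
def logDer (B : FLRW) (n : ℕ) (c a : Fin (n + 2)) (x : Fin (n + 2) → ℝ) : ℝ :=
  byIndex
    (byIndex (deriv B.F (x 0) / (2 * B.F (x 0))) 0 (fun _ => 0) a)
    (byIndex (deriv B.a (x 0) / B.a (x 0)) (B.k * x 1 / (1 - B.k * x 1 ^ 2)) (fun _ => 0) a)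
    (fun _ => byIndex (deriv B.a (x 0) / B.a (x 0)) (x 1)⁻¹
      (fun j => -(2 * x j.succ.succ) / (1 + normSq x)) a) c

/-- The derivatives `∂_b` of `logDer`. -/
def logDerDer (B : FLRW) (n : ℕ) (c a b : Fin (n + 2)) (x : Fin (n + 2) → ℝ) : ℝ :=
  byIndex
    (byIndex
      (byIndex ((deriv (deriv B.F) (x 0) * B.F (x 0) - deriv B.F (x 0) ^ 2) / (2 * B.F (x 0) ^ 2))
        0 (fun _ => 0) b) 0 (fun _ => 0) a)
    (byIndex
      (byIndex ((deriv (deriv B.a) (x 0) * B.a (x 0) - deriv B.a (x 0) ^ 2) / B.a (x 0) ^ 2)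
        0 (fun _ => 0) b)
      (byIndex 0 (B.k * (1 + B.k * x 1 ^ 2) / (1 - B.k * x 1 ^ 2) ^ 2) (fun _ => 0) b)
      (fun _ => 0) a)
    (fun _ => byIndex
      (byIndex ((deriv (deriv B.a) (x 0) * B.a (x 0) - deriv B.a (x 0) ^ 2) / B.a (x 0) ^ 2)
        0 (fun _ => 0) b)
      (byIndex 0 (-1 / x 1 ^ 2) (fun _ => 0) b)
      (fun j => byIndex 0 0 (fun i => (if i = j then -2 / (1 + normSq x) else 0)
        + 4 * x i.succ.succ * x j.succ.succ / (1 + normSq x) ^ 2) b) a) c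

theorem normSq_nonneg {n : ℕ} (x : Fin (n + 2) → ℝ) : 0 ≤ normSq x :=
  Finset.sum_nonneg fun _ _ => sq_nonneg _

theorem isOpen_domain (B : FLRW) (n : ℕ) : IsOpen (B.domain n) := by
  have h1 : IsOpen {x : Fin (n + 2) → ℝ | x 0 ∈ B.times} :=
    B.times_open.preimage (continuous_apply 0)
  have h2 : IsOpen {x : Fin (n + 2) → ℝ | 0 < x 1} :=
    isOpen_lt continuous_const (continuous_apply 1)
  have h3 : IsOpen {x : Fin (n + 2) → ℝ | B.k * x 1 ^ 2 < 1} :=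
    isOpen_lt (by fun_prop) continuous_const
  exact h1.inter (h2.inter h3)

theorem entries_ne_zero (B : FLRW) (n : ℕ) {x : Fin (n + 2) → ℝ} (hx : x ∈ B.domain n)
    (c : Fin (n + 2)) : B.entries n x c ≠ 0 := by
  obtain ⟨h0, h1, h2⟩ := hx
  have hF := B.F_pos _ h0
  have ha := B.a_ne _ h0
  have hk : 1 - B.k * x 1 ^ 2 ≠ 0 := by linarith
  have hs : 1 + normSq x ≠ 0 := by linarith [normSq_nonneg x]
  refine index_cases ?_ ?_ (fun i => ?_) c
  · simp [entries, hF.ne']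
  · simp [entries, ha, hk]
  · simp [entries, ha, hs, h1.ne']

theorem hasDerivAt_a (B : FLRW) {t : ℝ} (ht : t ∈ B.times) : HasDerivAt B.a (deriv B.a t) t :=
  ((B.a_contDiff.differentiableOn (by norm_num)).differentiableAt
    (B.times_open.mem_nhds ht)).hasDerivAt

theorem hasDerivAt_F (B : FLRW) {t : ℝ} (ht : t ∈ B.times) : HasDerivAt B.F (deriv B.F t) t :=
  ((B.F_contDiff.differentiableOn (by norm_num)).differentiableAt
    (B.times_open.mem_nhds ht)).hasDerivAt

theorem hasDerivAt_deriv_a (B : FLRW) {t : ℝ} (ht : t ∈ B.times) :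
    HasDerivAt (deriv B.a) (deriv (deriv B.a) t) t :=
  (((B.a_contDiff.deriv_of_isOpen (m := 1) B.times_open (by norm_num)).differentiableOn
    (by norm_num)).differentiableAt (B.times_open.mem_nhds ht)).hasDerivAt

theorem hasDerivAt_deriv_F (B : FLRW) {t : ℝ} (ht : t ∈ B.times) :
    HasDerivAt (deriv B.F) (deriv (deriv B.F) t) t :=
  (((B.F_contDiff.deriv_of_isOpen (m := 1) B.times_open (by norm_num)).differentiableOn
    (by norm_num)).differentiableAt (B.times_open.mem_nhds ht)).hasDerivAt

theorem hasDerivAt_normSq {n : ℕ} (x : Fin (n + 2) → ℝ) (j : Fin n) :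
    HasDerivAt (fun s : ℝ => normSq (Function.update x j.succ.succ s)) (2 * x j.succ.succ)
      (x j.succ.succ) := by
  have h : ∀ i ∈ (Finset.univ : Finset (Fin n)),
      HasDerivAt (fun s : ℝ => Function.update x j.succ.succ s i.succ.succ ^ 2)
        (if i = j then 2 * x j.succ.succ else 0) (x j.succ.succ) := by
    intro i _
    by_cases hij : i = j
    · subst hij
      simpa using hasDerivAt_pow 2 (x i.succ.succ)
    · simpa [hij] using hasDerivAt_const (x j.succ.succ) (x i.succ.succ ^ 2)
  simpa [normSq] using HasDerivAt.fun_sum h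

theorem normSq_update_zero {n : ℕ} (x : Fin (n + 2) → ℝ) (s : ℝ) :
    normSq (Function.update x 0 s) = normSq x := by
  simp [normSq]

theorem normSq_update_one {n : ℕ} (x : Fin (n + 2) → ℝ) (s : ℝ) :
    normSq (Function.update x 1 s) = normSq x := by
  simp [normSq]

theorem hasDerivAt_entries (B : FLRW) (n : ℕ) {x : Fin (n + 2) → ℝ} (hx : x ∈ B.domain n)
    (a c : Fin (n + 2)) :
    HasDerivAt (fun s : ℝ => B.entries n (Function.update x a s) c)
      (2 * B.logDer n c a x * B.entries n x c) (x a) := by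
  obtain ⟨h0, h1, h2⟩ := hx
  have hF := (B.F_pos _ h0).ne'
  have ha := B.a_ne _ h0
  have hk : 1 - B.k * x 1 ^ 2 ≠ 0 := by linarith
  have hr := h1.ne'
  have hs : 1 + normSq x ≠ 0 := by linarith [normSq_nonneg x]
  have dF := B.hasDerivAt_F h0
  have da := B.hasDerivAt_a h0
  refine index_cases ?_ ?_ (fun i => ?_) c
  · refine index_cases ?_ ?_ (fun j => ?_) a <;> simp [entries, logDer]
    · refine dF.neg.congr_deriv ?_
      field_simp
    · exact hasDerivAt_const _ _
    · exact hasDerivAt_const _ _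
  · refine index_cases ?_ ?_ (fun j => ?_) a <;> simp [entries, logDer]
    · refine ((da.pow 2).div_const _).congr_deriv ?_
      field_simp
      ring
    · refine ((hasDerivAt_const _ _).div
        ((((hasDerivAt_id' (x 1)).pow 2).const_mul B.k).const_sub 1) hk).congr_deriv ?_
      simp
      field_simp
    · exact hasDerivAt_const _ _
  · refine index_cases ?_ ?_ (fun j => ?_) a <;>
      simp [entries, logDer, normSq_update_zero, normSq_update_one]
    · refine (((da.pow 2).mul_const _).mul_const _).congr_deriv ?_
      field_simp
      ring
    · refine ((((hasDerivAt_id' (x 1)).pow 2).const_mul _).mul_const _).congr_deriv ?_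
      simp
      field_simp
    · refine ((((hasDerivAt_const _ _).div (((hasDerivAt_normSq x j).const_add 1).pow 2)
        (by simpa using hs))).const_mul _).congr_deriv ?_
      simp
      field_simp

theorem hasDerivAt_logDer (B : FLRW) (n : ℕ) {x : Fin (n + 2) → ℝ} (hx : x ∈ B.domain n)
    (c a b : Fin (n + 2)) :
    HasDerivAt (fun s : ℝ => B.logDer n c a (Function.update x b s))
      (B.logDerDer n c a b x) (x b) := by
  obtain ⟨h0, h1, h2⟩ := hx
  have hF := (B.F_pos _ h0).ne'
  have ha := B.a_ne _ h0
  have hk : 1 - B.k * x 1 ^ 2 ≠ 0 := by linarith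
  have hr := h1.ne'
  have hs : 1 + normSq x ≠ 0 := by linarith [normSq_nonneg x]
  have dF := B.hasDerivAt_F h0
  have da := B.hasDerivAt_a h0
  have ddF := B.hasDerivAt_deriv_F h0
  have dda := B.hasDerivAt_deriv_a h0
  have dH : HasDerivAt (fun s => deriv B.a s / B.a s)
      ((deriv (deriv B.a) (x 0) * B.a (x 0) - deriv B.a (x 0) ^ 2) / B.a (x 0) ^ 2) (x 0) := by
    refine (dda.div da ha).congr_deriv ?_
    field_simp
  refine index_cases ?_ ?_ (fun _ => ?_) c
  · refine index_cases ?_ ?_ (fun _ => ?_) a <;> refine index_cases ?_ ?_ (fun _ => ?_) b <;>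
      simp [logDer, logDerDer] <;> try exact hasDerivAt_const _ _
    refine (ddF.div (dF.const_mul 2) (by simpa using hF)).congr_deriv ?_
    field_simp
  · refine index_cases ?_ ?_ (fun _ => ?_) a <;> refine index_cases ?_ ?_ (fun _ => ?_) b <;>
      simp [logDer, logDerDer] <;> first | exact dH | exact hasDerivAt_const _ _ | skip
    refine (((hasDerivAt_id' (x 1)).const_mul B.k).div
      ((((hasDerivAt_id' (x 1)).pow 2).const_mul B.k).const_sub 1) hk).congr_deriv ?_
    simp
    field_simp
    ring
  · refine index_cases ?_ ?_ (fun j => ?_) a <;> refine index_cases ?_ ?_ (fun l => ?_) b <;>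
      simp [logDer, logDerDer, normSq_update_zero, normSq_update_one] <;>
      first | exact dH | exact hasDerivAt_const _ _ | skip
    · refine (hasDerivAt_inv hr).congr_deriv ?_
      field_simp
    · by_cases hlj : l = j
      · subst hlj
        simp
        refine ((((hasDerivAt_id' (x l.succ.succ)).const_mul 2).neg).div
          ((hasDerivAt_normSq x l).const_add 1) (by simpa using hs)).congr_deriv ?_
        simp
        field_simp
        ring
      · simp [hlj, Ne.symm hlj]
        refine ((hasDerivAt_const _ _).div
          ((hasDerivAt_normSq x l).const_add 1) (by simpa using hs)).congr_deriv ?_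
        simp
        field_simp
        ring

theorem diagonalJet (B : FLRW) (n : ℕ) :
    DiagonalJet (B.domain n) (B.entries n) (B.logDer n) (B.logDerDer n) where
  isOpen := B.isOpen_domain n
  ne_zero _ hx := B.entries_ne_zero n hx
  hasDerivAt_metric _ hx := B.hasDerivAt_entries n hx
  hasDerivAt_log _ hx := B.hasDerivAt_logDer n hx

end FLRW

end

/-! ### Curvature and invariants of the FLRW metric -/

noncomputable section

namespace FLRW

open CoordCurv

/-- The sectional curvature of the planes containing the time direction. -/
def timeCurv (B : FLRW) (t : ℝ) : ℝ :=
  deriv (deriv B.a) t / (B.a t * B.F t) - deriv B.a t * deriv B.F t / (2 * B.a t * B.F t ^ 2)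

/-- The sectional curvature of the spatial planes. -/
def spaceCurv (B : FLRW) (t : ℝ) : ℝ :=
  B.k / B.a t ^ 2 + deriv B.a t ^ 2 / (B.a t ^ 2 * B.F t)

/-- The sectional curvature of the coordinate plane of the indices `a` and `b`. -/
def sectCurv (B : FLRW) {n : ℕ} (t : ℝ) (a b : Fin (n + 2)) : ℝ :=
  if a = 0 ∨ b = 0 then B.timeCurv t else B.spaceCurv t

theorem logDerDer_symm (B : FLRW) (n : ℕ) (x : Fin (n + 2) → ℝ) (c a b : Fin (n + 2)) :
    B.logDerDer n c a b x = B.logDerDer n c b a x := by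
  refine index_cases ?_ ?_ (fun _ => ?_) c <;> refine index_cases ?_ ?_ (fun i => ?_) a <;>
    refine index_cases ?_ ?_ (fun j => ?_) b <;> simp [logDerDer]
  by_cases h : i = j
  · subst h
    simp
  · simp [h, Ne.symm h]
    ring

/-- In the angular directions the conformal factor of g^{ee} cancels the denominators of the
logarithmic derivatives, so each e contributes y_e²/(a² r²) and the total is |y|²/(a² r²). -/
theorem sum_logDer_mul (B : FLRW) (n : ℕ) {x : Fin (n + 2) → ℝ} (hx : x ∈ B.domain n)
    (a b : Fin (n + 2)) :
    ∑ e, B.entries n x a / B.entries n x e * B.logDer n a e x * B.logDer n b e x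
      = B.entries n x a * (-(B.logDer n a 0 x * B.logDer n b 0 x / B.F (x 0))
        + (1 - B.k * x 1 ^ 2) / B.a (x 0) ^ 2 * B.logDer n a 1 x * B.logDer n b 1 x
        + byIndex 0 0 (fun _ => byIndex 0 0
            (fun _ => normSq x / (B.a (x 0) ^ 2 * x 1 ^ 2)) b) a) := by
  have hne := B.entries_ne_zero n hx
  obtain ⟨h0, h1, h2⟩ := hx
  have hF := (B.F_pos _ h0).ne'
  have ha := B.a_ne _ h0
  have hk : 1 - B.k * x 1 ^ 2 ≠ 0 := by linarith
  have hr := h1.ne'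
  have hs : 1 + normSq x ≠ 0 := by linarith [normSq_nonneg x]
  rw [Fin.sum_univ_succ, Fin.sum_univ_succ]
  have hsum : ∑ i : Fin n, B.entries n x a / B.entries n x i.succ.succ
      * B.logDer n a i.succ.succ x * B.logDer n b i.succ.succ x
      = B.entries n x a * byIndex 0 0 (fun _ => byIndex 0 0
            (fun _ => normSq x / (B.a (x 0) ^ 2 * x 1 ^ 2)) b) a := by
    refine index_cases ?_ ?_ (fun i => ?_) a
    · simp [logDer]
    · simp [logDer]
    · refine index_cases ?_ ?_ (fun j => ?_) b
      · simp [logDer]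
      · simp [logDer]
      · have h : ∀ l : Fin n, B.entries n x i.succ.succ / B.entries n x l.succ.succ
            * B.logDer n i.succ.succ l.succ.succ x * B.logDer n j.succ.succ l.succ.succ x
            = 4 / (1 + normSq x) ^ 2 * x l.succ.succ ^ 2 := by
          intro l
          simp [entries, logDer]
          field_simp
          ring
        simp only [h, ← Finset.mul_sum, byIndex_succ_succ]
        rw [show ∑ l : Fin n, x l.succ.succ ^ 2 = normSq x from rfl]
        simp [entries]
        field_simp
  rw [hsum, Fin.succ_zero_eq_one]
  have e0 : B.entries n x 0 = -B.F (x 0) := rfl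
  have e1 : B.entries n x 1 = B.a (x 0) ^ 2 / (1 - B.k * x 1 ^ 2) := rfl
  rw [e0, e1]
  field_simp
  ring

/-- The characteristic case has three angular indices: there the mixed derivative 4 y_b
y_c/(1+|y|²)² equals the product of the two logarithmic derivatives. -/
theorem logDer_mixed (B : FLRW) (n : ℕ) {x : Fin (n + 2) → ℝ} (hx : x ∈ B.domain n)
    (a b c : Fin (n + 2)) (hab : a ≠ b) (hac : a ≠ c) (hbc : b ≠ c) :
    B.logDerDer n a c b x + B.logDer n a c x * B.logDer n a b x
      - B.logDer n b c x * B.logDer n a b x - B.logDer n c b x * B.logDer n a c x = 0 := by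
  obtain ⟨h0, h1, h2⟩ := hx
  have hr := h1.ne'
  have hs : 1 + normSq x ≠ 0 := by linarith [normSq_nonneg x]
  revert hab hac hbc
  refine index_cases ?_ ?_ (fun i => ?_) a <;> refine index_cases ?_ ?_ (fun j => ?_) b <;>
    refine index_cases ?_ ?_ (fun l => ?_) c <;> simp [logDer, logDerDer] <;> intros <;>
    first
      | (simp_all; done)
      | (field_simp; done)
      | (field_simp; ring; done)
      | skip
  simp_all
  field_simp
  ring

/-- For two angular directions this is a Gauss equation: the sphere contributes 1/(a² r²), the
radial derivative -(1 - k r²)/(a² r²) and the time derivative ȧ²/(a² F), which add up to the spatial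
curvature. -/
theorem logDer_sect (B : FLRW) (n : ℕ) {x : Fin (n + 2) → ℝ} (hx : x ∈ B.domain n)
    (a b : Fin (n + 2)) (hab : a ≠ b) :
    -B.logDerDer n b a a x - B.entries n x a / B.entries n x b
        * (2 * (B.logDer n a b x - B.logDer n b b x) * B.logDer n a b x + B.logDerDer n a b b x)
      + 2 * B.logDer n a a x * B.logDer n b a x
      - ∑ e, B.entries n x a / B.entries n x e * B.logDer n a e x * B.logDer n b e x
      - B.logDer n b a x ^ 2
      + B.entries n x a / B.entries n x b * B.logDer n a b x ^ 2
      = B.sectCurv (x 0) a b * B.entries n x a := by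
  rw [B.sum_logDer_mul n hx]
  obtain ⟨h0, h1, h2⟩ := hx
  have hF := (B.F_pos _ h0).ne'
  have ha := B.a_ne _ h0
  have hk : 1 - B.k * x 1 ^ 2 ≠ 0 := by linarith
  have hk' : 1 - x 1 ^ 2 * B.k ≠ 0 := by rwa [mul_comm]
  have hr := h1.ne'
  have hs : 1 + normSq x ≠ 0 := by linarith [normSq_nonneg x]
  revert hab
  refine index_cases ?_ ?_ (fun i => ?_) a <;> refine index_cases ?_ ?_ (fun j => ?_) b <;>
    simp [logDer, logDerDer, entries, sectCurv, timeCurv, spaceCurv] <;> intros <;>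
    first
      | (field_simp; done)
      | (field_simp; ring)

theorem metric_eq_diagonal (B : FLRW) (n : ℕ) :
    B.metric n = fun y => Matrix.diagonal (B.entries n y) := rfl

theorem sectionalAt (B : FLRW) (n : ℕ) {x : Fin (n + 2) → ℝ} (hx : x ∈ B.domain n) :
    SectionalAt (B.metric n) x (B.entries n x) (B.sectCurv (x 0)) where
  metric_eq := rfl
  ne_zero := B.entries_ne_zero n hx
  riemannUp_eq := by
    rw [metric_eq_diagonal]
    refine (B.diagonalJet n).riemannUp_eq hx (fun a b => ?_) (fun a b c => B.logDerDer_symm n x c a b)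
      (B.logDer_mixed n hx) (B.logDer_sect n hx)
    simp only [sectCurv, or_comm]

/-- The time direction lies in n + 1 coordinate planes, all of curvature K_t; a spatial direction
lies in one such plane and in n spatial ones. -/
theorem sum_sectCurv (B : FLRW) (n : ℕ) (t : ℝ) (a : Fin (n + 2)) :
    ∑ d, B.sectCurv t a d - B.sectCurv t a a
      = if a = 0 then (n + 1) * B.timeCurv t else B.timeCurv t + n * B.spaceCurv t := by
  rw [Fin.sum_univ_succ]
  by_cases h : a = 0
  · simp [sectCurv, h]
  · simp [sectCurv, h]
    ring

theorem scalarCurv_metric_eq_curv (B : FLRW) (n : ℕ) {x : Fin (n + 2) → ℝ}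
    (hx : x ∈ B.domain n) : scalarCurv (B.metric n) x
      = 2 * (n + 1) * B.timeCurv (x 0) + n * (n + 1) * B.spaceCurv (x 0) := by
  rw [(B.sectionalAt n hx).scalarCurv_eq]
  simp only [sum_sectCurv]
  rw [Fin.sum_univ_succ]
  simp
  ring

theorem scalarCurv_metric (B : FLRW) (n : ℕ) {x : Fin (n + 2) → ℝ} (hx : x ∈ B.domain n) :
    scalarCurv (B.metric n) x = B.Sig (n + 2) (x 0) := by
  rw [B.scalarCurv_metric_eq_curv n hx]
  have hF := (B.F_pos _ hx.1).ne'
  have ha := B.a_ne _ hx.1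
  simp only [Sig, timeCurv, spaceCurv]
  push_cast
  field_simp
  ring

/-- Subtracting the mean of the Ricci eigenvalues leaves multiples of K_s - K_t; tracelessness
forces the ratio -(n+1) : 1. -/
theorem sum_sectCurv_sub (B : FLRW) (n : ℕ) {x : Fin (n + 2) → ℝ} (hx : x ∈ B.domain n)
    (a : Fin (n + 2)) :
    ∑ d, B.sectCurv (x 0) a d - B.sectCurv (x 0) a a
        - scalarCurv (B.metric n) x / Fintype.card (Fin (n + 2))
      = B.Gam (n + 2) (x 0) * if a = 0 then -((n : ℝ) + 1) else 1 := by
  rw [B.scalarCurv_metric_eq_curv n hx, sum_sectCurv]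
  have hF := (B.F_pos _ hx.1).ne'
  have ha := B.a_ne _ hx.1
  have hn : (n : ℝ) + 2 ≠ 0 := by positivity
  simp only [Gam, timeCurv, spaceCurv, Fintype.card_fin]
  push_cast
  split_ifs <;> field_simp <;> ring

theorem tracelessRicciUp_metric (B : FLRW) (n : ℕ) {x : Fin (n + 2) → ℝ} (hx : x ∈ B.domain n)
    (a b : Fin (n + 2)) :
    tracelessRicciUp (B.metric n) x a b = B.Gam (n + 2) (x 0) *
      (-((n + 2 : ℕ) : ℝ) * ((if a = 0 then 1 else 0) * (if b = 0 then 1 else 0))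
        + (if a = b then 1 else 0)) := by
  rw [(B.sectionalAt n hx).tracelessRicciUp_eq, B.sum_sectCurv_sub n hx]
  by_cases hab : a = b
  · subst hab
    by_cases h : a = 0
    · simp only [h, if_true]
      push_cast
      ring
    · simp [h]
  · by_cases h : a = 0
    · have hb : b ≠ 0 := fun hb => hab (h.trans hb.symm)
      simp [hab, hb]
    · simp [hab, h]

/-- With ρ the Ricci eigenvalues, (ρ_a + ρ_b)/(D-2) - R/((D-1)(D-2)) gives back K_t or K_s. The
bound on n makes D - 2 invertible. -/
theorem weyl_metric_eq_zero (B : FLRW) {n : ℕ} (hn : 1 ≤ n) {x : Fin (n + 2) → ℝ}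
    (hx : x ∈ B.domain n) (a b c d : Fin (n + 2)) : weyl (B.metric n) x a b c d = 0 := by
  refine (B.sectionalAt n hx).weyl_eq_zero (fun a b hab => ?_) a b c d
  rw [B.scalarCurv_metric_eq_curv n hx, sum_sectCurv, sum_sectCurv]
  have hn0 : (n : ℝ) ≠ 0 := by exact_mod_cast (by omega : n ≠ 0)
  have hn1 : (n : ℝ) + 1 ≠ 0 := by positivity
  have e1 : ((Fintype.card (Fin (n + 2)) : ℕ) : ℝ) - 2 = n := by simp
  have e2 : ((Fintype.card (Fin (n + 2)) : ℕ) : ℝ) - 1 = n + 1 := by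
    simp only [Fintype.card_fin]
    push_cast
    ring
  rw [e1, e2]
  by_cases h : a = 0
  · have hb : b ≠ 0 := fun hb => hab (h.trans hb.symm)
    simp only [sectCurv, h, hb, true_or, if_true, if_false]
    field_simp
    ring
  · by_cases hb : b = 0
    · simp only [sectCurv, h, hb, or_true, if_true, if_false]
      field_simp
      ring
    · simp only [sectCurv, h, hb, or_self, if_false]
      field_simp
      ring

/-- The eigenvalues of `Z_a{}^b / Γ`. -/
def tracelessEigenvalue (n : ℕ) (a : Fin (n + 2)) : ℝ := if a = 0 then -((n : ℝ) + 1) else 1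

theorem invariant_metric_eq (B : FLRW) (n : ℕ) {x : Fin (n + 2) → ℝ} (hx : x ∈ B.domain n)
    (m : ℕ) {q : ℕ} (σ : Contraction 0 q) :
    invariant (B.metric n) m σ x
      = diagonalContraction (tracelessEigenvalue n) σ
        * B.Sig (n + 2) (x 0) ^ m * B.Gam (n + 2) (x 0) ^ q := by
  have S := B.sectionalAt n hx
  rw [← B.scalarCurv_metric n hx]
  refine invariant_eq_diagonalContraction S.metric_eq S.ne_zero (fun a b => ?_) m σ
  rw [S.tracelessRicci_eq, B.sum_sectCurv_sub n hx, tracelessEigenvalue]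

end FLRW

end
/-- The dimension is `D = n + 2 ≥ 3`. On every FLRW background:
the Ricci scalar is `Σ` and `Z_a{}^b = Γ (-D δ_a^t δ_t^b + δ_a^b)`;
every invariant with at least one Weyl tensor vanishes;
every invariant with `m` Ricci scalars and `q` traceless Ricci tensors is `c Σ^m Γ^q`, with a real
constant `c` that depends only on the dimension, `m` and the contraction, not on the background;
any two invariants of the same type `(m, p, q)`, the second of which is not zero on all backgrounds,
are proportional to each other. -/
theorem proposition2 (n : ℕ) (hn : 1 ≤ n) :
    (∀ (B : FLRW) (x : Fin (n + 2) → ℝ), x ∈ B.domain n →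
      CoordCurv.scalarCurv (B.metric n) x = B.Sig (n + 2) (x 0) ∧
      ∀ a b : Fin (n + 2), CoordCurv.tracelessRicciUp (B.metric n) x a b =
        B.Gam (n + 2) (x 0) *
          (-((n + 2 : ℕ) : ℝ) * ((if a = 0 then 1 else 0) * (if b = 0 then 1 else 0))
            + (if a = b then 1 else 0))) ∧
    (∀ (m p q : ℕ) (σ : CoordCurv.Contraction p q), 1 ≤ p →
      ∀ (B : FLRW) (x : Fin (n + 2) → ℝ), x ∈ B.domain n →
        CoordCurv.invariant (B.metric n) m σ x = 0) ∧
    (∀ (m q : ℕ) (σ : CoordCurv.Contraction 0 q), ∃ c : ℝ,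
      ∀ (B : FLRW) (x : Fin (n + 2) → ℝ), x ∈ B.domain n →
        CoordCurv.invariant (B.metric n) m σ x =
          c * B.Sig (n + 2) (x 0) ^ m * B.Gam (n + 2) (x 0) ^ q) ∧
    (∀ (m p q : ℕ) (σ τ : CoordCurv.Contraction p q),
      (∃ (B : FLRW) (x : Fin (n + 2) → ℝ), x ∈ B.domain n ∧
        CoordCurv.invariant (B.metric n) m τ x ≠ 0) →
      ∃ c : ℝ, ∀ (B : FLRW) (x : Fin (n + 2) → ℝ), x ∈ B.domain n →
        CoordCurv.invariant (B.metric n) m σ x =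
          c * CoordCurv.invariant (B.metric n) m τ x) := by

  refine ⟨fun B x hx => ⟨B.scalarCurv_metric n hx, B.tracelessRicciUp_metric n hx⟩, ?_, ?_, ?_⟩
  · intro m p q σ hp B x hx
    exact CoordCurv.invariant_eq_zero (B.weyl_metric_eq_zero hn hx) m σ hp
  · intro m q σ
    exact ⟨_, fun B x hx => B.invariant_metric_eq n hx m σ⟩
  · intro m p q σ τ ⟨B, x, hx, hne⟩
    -- For p > 0 the invariant of τ would vanish everywhere. For p = 0 its non-vanishing at one
    -- point makes the constant of τ non-zero, and c is the quotient of the two constants.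
    rcases Nat.eq_zero_or_pos p with rfl | hp
    · rw [B.invariant_metric_eq n hx m τ] at hne
      have hτ := left_ne_zero_of_mul (left_ne_zero_of_mul hne)
      refine ⟨CoordCurv.diagonalContraction (FLRW.tracelessEigenvalue n) σ
        / CoordCurv.diagonalContraction (FLRW.tracelessEigenvalue n) τ, fun B' x' hx' => ?_⟩
      rw [B'.invariant_metric_eq n hx' m σ, B'.invariant_metric_eq n hx' m τ, ← mul_assoc,
        ← mul_assoc, div_mul_cancel₀ _ hτ]
    · exact absurd (CoordCurv.invariant_eq_zero (B.weyl_metric_eq_zero hn hx) m τ hp) hne
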